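/- **Setting.** Consider an M/M/1 queue with arrival rate $\lambda>0$, service rate $\mu>0$, flow cost $c\ge 0$ per unit of time in the system, and reward $r\ge 0$ upon service completion. Time is divided into rounds $k=0,1,2,\dots$. The durations of the rounds are independent exponential random variables with rate $\lambda+\mu$. Each round is ended by an event, which is an arrival with probability $\lambda/(\lambda+\mu)$ and a service completion with probability $\mu/(\lambda+\mu)$, independently of the durations, of the past and of any randomization by the customers. *Regime.* A (work-conserving) queueing regime consists of a set of states partitioned as $\mathcal X=\mathcal X_0\uplus\mathcal X_1\uplus\cdots$ with $\mathcal X_0$ a singleton ($x\in\mathcal X_m$ means that there are $m$ customers in the system, in positions $1,\dots,m$, the one in position $1$ being served), and of maps as follows. For $x\in\mathcal X_m$, an arriving customer is placed at position $\pi(x)\in\{1,\dots,m+1\}$ and the state becomes $\alpha(x)\in\mathcal X_{m+1}$; a service completion (if $m\ge1$) leads to $\xi(x)\in\mathcal X_{m-1}$; reneging of the customer in position $i\in\{1,\dots,m\}$ leads to $\rho_i(x)\in\mathcal X_{m-1}$, where $\rho_i(\rho_j(x))=\rho_{j-1}(\rho_i(x))$ for $1\le i<j\le m$. A set of customers in positions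 $i_1<\dots<i_l$ reneges by $\rho_{i_1}\circ\cdots\circ\rho_{i_l}$. None of these events changes the relative order of the other customers. *The number $D_n$.* For $n\ge1$ let $y_0=n$ and, for $k\ge1$, let $y_k=\min(y_{k-1}+1,n)$ if the $k$-th event is an arrival and $y_k=\max(y_{k-1}-1,0)$ if it is a service. Let $\theta_n$ be the probability that $y_1,y_2,\dots$ reaches $0$ before it reaches $n$, let $T_n$ be the expected value of the least $k\ge1$ with $y_k\in\{0,n\}$, and let $$D_n=r\,\theta_n-\frac{c}{\lambda+\mu}\,T_n .$$ *Customer and payoff.* A customer is at position $n\ge1$ in a state with at least $n$ customers, at the beginning of round $0$. She stays in the system, until she is served, as long as her position is at most $n$; she reneges at the beginning of a round if the event that starts the round has moved her to a position larger than $n$. The other (present and future) customers renege according to arbitrary non-anticipating strategies, possibly history-dependent and randomized. Her payoff is $r$ if she is eventually served ($0$ otherwise), minus $c$ times the time she spends in the system. **Lemma.** For every regime, every such initial state and all strategies of the other customers, the expected time that the customer spends in the system is finite, so that her expected payoff is well defined, and: 1. if $D_n\ge 0$, then her expected payoff is nonnegative; 2. if $D_n>0$, then her expected payoff is strictly positive.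 -/

import Mathlib

open MeasureTheory ProbabilityTheory
open scoped ENNReal

/-- A queueing environment: arrival rate `lam`, service rate `mu`, flow cost `c` per unit of time
spent in the system, reward `r` at service completion. -/
structure Environment where
  lam : ℝ
  mu : ℝ
  c : ℝ
  r : ℝ
  lam_pos : 0 < lam
  mu_pos : 0 < mu
  c_nonneg : 0 ≤ c
  r_nonneg : 0 ≤ r

namespace Environment

/-- The law of the type of a single event: an arrival (`true`) has probability `lam / (lam + mu)`,
a service completion (`false`) has probability `mu / (lam + mu)`. -/
noncomputable def eventLaw (E : Environment) : Measure Bool :=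
  ENNReal.ofReal (E.lam / (E.lam + E.mu)) • Measure.dirac true +
    ENNReal.ofReal (E.mu / (E.lam + E.mu)) • Measure.dirac false

instance (E : Environment) : IsProbabilityMeasure E.eventLaw := by
  have h1 := E.lam_pos
  have h2 := E.mu_pos
  refine ⟨?_⟩
  simp only [eventLaw, Measure.add_apply, Measure.smul_apply, measure_univ, smul_eq_mul, mul_one]
  rw [← ENNReal.ofReal_add (by positivity) (by positivity), ← add_div, div_self (by positivity),
    ENNReal.ofReal_one]

/-- The law of the sequence of event types (independent, identically distributed); coordinate `k`
is the type of the event that ends round `k` and starts round `k + 1`. -/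
noncomputable def eventSeqLaw (E : Environment) : Measure (ℕ → Bool) :=
  Measure.infinitePi (fun _ : ℕ => E.eventLaw)

end Environment

/-- The queue length under the threshold policy `n`, started with `n` customers, along a sequence of
event types: an arrival moves `y` to `min (y + 1) n`, a service moves `y` to `max (y - 1) 0`
(the subtraction of natural numbers is truncated at `0`). -/
def thresholdChain (n : ℕ) (e : ℕ → Bool) : ℕ → ℕ
  | 0 => n
  | k + 1 => if e k then min (thresholdChain n e k + 1) n else thresholdChain n e k - 1

/-- The number of rounds until the chain started at `n` reaches `0` or comes back to `n`, that is,
the least `k ≥ 1` with `y k = 0` or `y k = n` (and `∞` if there is none). -/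
noncomputable def exitTime (n : ℕ) (e : ℕ → Bool) : ℝ≥0∞ :=
  ⨅ (k : ℕ) (_ : 1 ≤ k ∧ (thresholdChain n e k = 0 ∨ thresholdChain n e k = n)), (k : ℝ≥0∞)

namespace Environment

/-- The probability that `y 1, y 2, …` reaches `0` before it reaches `n`, when `y 0 = n`. -/
noncomputable def theta (E : Environment) (n : ℕ) : ℝ :=
  E.eventSeqLaw.real {e | ∃ k, 1 ≤ k ∧ thresholdChain n e k = 0 ∧
    ∀ j, 1 ≤ j → j < k → thresholdChain n e j ≠ n}

/-- The expected number of rounds until `y 1, y 2, …` reaches `0` or `n`, when `y 0 = n`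
(this expectation is finite for all positive rates). -/
noncomputable def T (E : Environment) (n : ℕ) : ℝ :=
  (∫⁻ e, exitTime n e ∂E.eventSeqLaw).toReal

/-- `D n = r θ n - (c / (lam + mu)) T n`. -/
noncomputable def D (E : Environment) (n : ℕ) : ℝ :=
  E.r * E.theta n - E.c / (E.lam + E.mu) * E.T n

end Environment

universe u v

/-- A (work-conserving) queueing regime. The states with `n` customers are those of size `n`.
Positions are numbered from `1`, the customer in position `1` being served. The values
`renege i x` have a meaning only for `1 ≤ i ≤ size x`. -/
structure Regime where
  State : Type u
  size : State → ℕ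
  existsUnique_idle : ∃! x, size x = 0
  /-- the new state after an arrival -/
  arrive : State → State
  /-- the position at which a customer arriving in state `x` is placed -/
  position : State → ℕ
  /-- the new state after a service completion (an idle system stays idle) -/
  serve : State → State
  /-- the new state after the customer in position `i` reneges -/
  renege : ℕ → State → State
  size_arrive : ∀ x, size (arrive x) = size x + 1
  one_le_position : ∀ x, 1 ≤ position x
  position_le : ∀ x, position x ≤ size x + 1
  size_serve : ∀ x, size (serve x) = size x - 1
  size_renege : ∀ x i, 1 ≤ i → i ≤ size x → size (renege i x) = size x - 1
  renege_comm : ∀ x i j, 1 ≤ i → i < j → j ≤ size x →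
    renege i (renege j x) = renege (j - 1) (renege i x)

namespace Regime

/-- Simultaneous reneging of the customers in the positions `i₁ < ⋯ < iₖ` of `I`:
`ρ_{i₁} ∘ ⋯ ∘ ρ_{iₖ}`. -/
def renegeSet (R : Regime.{u}) (I : Finset ℕ) (x : R.State) : R.State :=
  (I.sort (· ≤ ·)).foldr R.renege x

end Regime

/-- The situation of a distinguished customer: she is in the system, the state of the system is `x`
and her position is `p`; or she has been served; or she has reneged. -/
inductive Situation (R : Regime.{u}) where
  | inSystem (x : R.State) (p : ℕ)
  | served
  | reneged

namespace Situation

variable {R : Regime.{u}}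

/-- The distinguished customer is in the system. -/
def IsPresent : Situation R → Prop
  | inSystem _ _ => True
  | served => False
  | reneged => False

/-- The effect of an event (`true`: arrival, `false`: service completion). An arriving customer
pushes back by one those whose position is not smaller than the one she is placed at. -/
def afterEvent (arrival : Bool) : Situation R → Situation R
  | inSystem x p =>
      if arrival then inSystem (R.arrive x) (if R.position x ≤ p then p + 1 else p)
      else if p = 1 then served else inSystem (R.serve x) (p - 1)
  | served => served
  | reneged => reneged

/-- The decision of the distinguished customer: she stays if her position is at most `n` and
reneges otherwise. -/
def afterDecision (n : ℕ) : Situation R → Situation R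
  | inSystem x p => if p ≤ n then inSystem x p else reneged
  | served => served
  | reneged => reneged

/-- The effect of the reneging of the opponents whose position is in `I`. The position of the
distinguished customer, and numbers that are not positions, are discarded from `I`. -/
def afterOpponents (I : Finset ℕ) : Situation R → Situation R
  | inSystem x p =>
      let J := (I ∩ Finset.Icc 1 (R.size x)).erase p
      inSystem (R.renegeSet J x) (p - (J.filter (· < p)).card)
  | served => served
  | reneged => reneged

/-- The situation in each round of a customer who starts at position `n` in state `x₀` and
stays as long as her position is at most `n`. Here `e k` is the type of the event that ends round
`k`, and `I k` are the opponents who renege in round `k`, named by their position at the beginning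
of the round, right after the event that starts it. At the beginning of a round the customer
decides simultaneously with the opponents, so on the basis of her position right after the event. -/
def run (n : ℕ) (x₀ : R.State) (e : ℕ → Bool) (I : ℕ → Finset ℕ) : ℕ → Situation R
  | 0 => afterOpponents (I 0) (afterDecision n (inSystem x₀ n))
  | k + 1 => afterOpponents (I (k + 1)) (afterDecision n (afterEvent (e k) (run n x₀ e I k)))

end Situation

/-- The arrival-and-service process on a filtered probability space, in rounds. Round `k` has the
physical length `duration k` and is ended by the event `isArrival k` (`true`: arrival, `false`:
service). `ℱ k` is what can be known at the beginning of round `k`: past events and durations,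
and possibly outcomes of randomization devices. Durations are exponential with rate `lam + mu`,
event types have law `eventLaw`, and `ℱ k`, `duration k`, `isArrival k` are independent. -/
structure EventProcess (E : Environment) {Ω : Type v} [mΩ : MeasurableSpace Ω] (P : Measure Ω)
    (ℱ : Filtration ℕ mΩ) where
  isArrival : ℕ → Ω → Bool
  duration : ℕ → Ω → ℝ
  measurable_isArrival : ∀ k, Measurable[ℱ (k + 1)] (isArrival k)
  measurable_duration : ∀ k, Measurable[ℱ (k + 1)] (duration k)
  map_isArrival : ∀ k, P.map (isArrival k) = E.eventLaw
  map_duration : ∀ k, P.map (duration k) = expMeasure (E.lam + E.mu)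
  indep_duration : ∀ k, Indep (ℱ k) (MeasurableSpace.comap (duration k) inferInstance) P
  indep_isArrival : ∀ k, Indep (ℱ k ⊔ MeasurableSpace.comap (duration k) inferInstance)
    (MeasurableSpace.comap (isArrival k) inferInstance) P

/-- The behaviour of the opponents (present and future) under arbitrary non-anticipating, possibly
history-dependent, randomized or correlated strategies: `leaves k ω` are the positions, at the
beginning of round `k`, of the opponents who renege in round `k`. They may renege immediately
(`leaves k` is then `ℱ k`-measurable) or later in the round, so that `leaves k` may depend on the
length of the round too, but not on the event that ends it. -/
structure OpponentBehavior {E : Environment} {Ω : Type v} [mΩ : MeasurableSpace Ω]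
    {P : Measure Ω} {ℱ : Filtration ℕ mΩ} (N : EventProcess E P ℱ) where
  leaves : ℕ → Ω → Finset ℕ
  measurableSet_leaves : ∀ k i,
    MeasurableSet[ℱ k ⊔ MeasurableSpace.comap (N.duration k) inferInstance] {ω | i ∈ leaves k ω}

section Payoff

variable {E : Environment} {Ω : Type v} [mΩ : MeasurableSpace Ω] {P : Measure Ω}
  {ℱ : Filtration ℕ mΩ}

/-- The situation in round `k` of the customer who starts at position `n` in state `x₀` and
stays as long as her position is at most `n`. -/
def situation (R : Regime.{u}) (N : EventProcess E P ℱ) (S : OpponentBehavior N) (n : ℕ)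
    (x₀ : R.State) (ω : Ω) (k : ℕ) : Situation R :=
  Situation.run n x₀ (fun j => N.isArrival j ω) (fun j => S.leaves j ω) k

open Classical in
/-- The physical time that this customer spends in the system. -/
noncomputable def sojournTime (R : Regime.{u}) (N : EventProcess E P ℱ) (S : OpponentBehavior N)
    (n : ℕ) (x₀ : R.State) (ω : Ω) : ℝ≥0∞ :=
  ∑' k, if (situation R N S n x₀ ω k).IsPresent then ENNReal.ofReal (N.duration k ω) else 0

open Classical in
/-- The payoff of this customer: the reward if she is eventually served, minus the flow cost. -/
noncomputable def payoff (R : Regime.{u}) (N : EventProcess E P ℱ) (S : OpponentBehavior N)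
    (n : ℕ) (x₀ : R.State) (ω : Ω) : ℝ :=
  (if ∃ k, situation R N S n x₀ ω k = Situation.served then E.r else 0) -
    E.c * (sojournTime R N S n x₀ ω).toReal

end Payoff

/-! Let `V` (`potential`) satisfy `V (n + 1) = 0`, `V n = δ`, and gain on average `κ = c / (lam +
mu)`, the mean cost of a round, at each step of the walk that moves back at every arrival and
forward at every service. Choose `δ` so that `V 0 = r` (`exists_potential_zero_eq`). Then `δ` is the
customer's expected payoff in the worst case, where every arrival is placed ahead of her and no
opponent reneges.

Optional stopping of `V` along the threshold chain gives `D n = δ * (theta n + arrivalProb)`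
(`D_eq`). The second term appears because an arrival at the first step returns the chain to `n`,
worth `δ`, and not to `n + 1`, worth `0`. So `D n` and `δ` have the same sign.

If `δ ≥ 0`, then `V` is nonnegative and nonincreasing, so an arrival placed behind the customer, or
reneging ahead of her, is no worse for her than in the walk. Hence her value minus `κ` times the
rounds spent is a submartingale (`meanValue_add_le`) with initial mean at least `δ`. The same
argument with `κ = 1`, `δ = 0` bounds the expected number of rounds. Passing to the limit, the
payoff is at least `δ` (`le_integral_payoff`). -/

/-! ### Event probabilities and the potential -/

namespace Environment

/-- The probability that an event is an arrival. -/
noncomputable def arrivalProb (E : Environment) : ℝ := E.lam / (E.lam + E.mu)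

/-- The probability that an event is a service completion. -/
noncomputable def serviceProb (E : Environment) : ℝ := E.mu / (E.lam + E.mu)

variable (E : Environment)

lemma arrivalProb_pos : 0 < E.arrivalProb :=
  div_pos E.lam_pos (add_pos E.lam_pos E.mu_pos)

lemma serviceProb_pos : 0 < E.serviceProb :=
  div_pos E.mu_pos (add_pos E.lam_pos E.mu_pos)

lemma arrivalProb_add_serviceProb : E.arrivalProb + E.serviceProb = 1 := by
  have := add_pos E.lam_pos E.mu_pos
  rw [arrivalProb, serviceProb, ← add_div, div_self this.ne']

lemma eventLaw_real_true : E.eventLaw.real {true} = E.arrivalProb := by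
  have := E.arrivalProb_pos.le
  simp [Measure.real, eventLaw, arrivalProb] at this ⊢
  exact this

lemma eventLaw_real_false : E.eventLaw.real {false} = E.serviceProb := by
  have := E.serviceProb_pos.le
  simp [Measure.real, eventLaw, serviceProb] at this ⊢
  exact this

/-- The increments of the potential, counted from the threshold downwards. -/
noncomputable def potentialIncrement (κ δ : ℝ) : ℕ → ℝ
  | 0 => δ
  | j + 1 => (κ + E.arrivalProb * potentialIncrement κ δ j) / E.serviceProb

/-- The function `V` with `V (n + 1) = 0`, `V n = δ` and
`V p + κ = arrivalProb * V (p + 1) + serviceProb * V (p - 1)` for `1 ≤ p ≤ n`. -/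
noncomputable def potential (κ δ : ℝ) (n p : ℕ) : ℝ :=
  ∑ j ∈ Finset.range (n + 1 - p), E.potentialIncrement κ δ j

lemma potential_self (κ δ : ℝ) (n : ℕ) : E.potential κ δ n n = δ := by
  simp [potential, potentialIncrement]

lemma potential_succ_self (κ δ : ℝ) (n : ℕ) : E.potential κ δ n (n + 1) = 0 := by
  simp [potential]

/-- In terms of the increments `d j = V (n - j) - V (n - j + 1)` this is `serviceProb * d (j + 1) =
κ + arrivalProb * d j`, at `p = n - j`. -/
lemma potential_step (κ δ : ℝ) {n p : ℕ} (h1 : 1 ≤ p) (h2 : p ≤ n) :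
    E.arrivalProb * E.potential κ δ n (p + 1) + E.serviceProb * E.potential κ δ n (p - 1)
      = E.potential κ δ n p + κ := by
  obtain ⟨j, rfl⟩ := Nat.exists_eq_add_of_le h2
  obtain ⟨q, rfl⟩ := Nat.exists_eq_add_of_le' h1
  have e1 : q + 1 + j + 1 - (q + 1 + 1) = j := by omega
  have e2 : q + 1 + j + 1 - (q + 1 - 1) = j + 1 + 1 := by omega
  have e3 : q + 1 + j + 1 - (q + 1) = j + 1 := by omega
  simp only [potential, e1, e2, e3, Finset.sum_range_succ, potentialIncrement]
  have hm := E.serviceProb_pos.ne'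
  have hl := E.arrivalProb_add_serviceProb
  field_simp
  linear_combination (∑ x ∈ Finset.range j, E.potentialIncrement κ δ x
    + E.potentialIncrement κ δ j) * hl

lemma potentialIncrement_nonneg {κ δ : ℝ} (hκ : 0 ≤ κ) (hδ : 0 ≤ δ) (j : ℕ) :
    0 ≤ E.potentialIncrement κ δ j := by
  induction j with
  | zero => exact hδ
  | succ j ih =>
    exact div_nonneg (add_nonneg hκ (mul_nonneg E.arrivalProb_pos.le ih)) E.serviceProb_pos.le

lemma potential_antitone {κ δ : ℝ} (hκ : 0 ≤ κ) (hδ : 0 ≤ δ) (n : ℕ) :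
    Antitone (E.potential κ δ n) := fun p q h ↦
  Finset.sum_le_sum_of_subset_of_nonneg (Finset.range_mono (by omega))
    fun j _ _ ↦ E.potentialIncrement_nonneg hκ hδ j

lemma potential_nonneg {κ δ : ℝ} (hκ : 0 ≤ κ) (hδ : 0 ≤ δ) (n p : ℕ) :
    0 ≤ E.potential κ δ n p :=
  Finset.sum_nonneg fun j _ ↦ E.potentialIncrement_nonneg hκ hδ j

lemma potentialIncrement_eq (κ δ : ℝ) (j : ℕ) :
    E.potentialIncrement κ δ j =
      E.potentialIncrement κ 0 j + (E.arrivalProb / E.serviceProb) ^ j * δ := by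
  induction j with
  | zero => simp [potentialIncrement]
  | succ j ih =>
    have hm := E.serviceProb_pos.ne'
    rw [potentialIncrement, ih, potentialIncrement, pow_succ]
    field_simp
    ring

/-- `V 0` is affine in `δ` with positive slope. The solution may be negative; its sign is read off
later from `D_eq`. -/
lemma exists_potential_zero_eq (κ r : ℝ) (n : ℕ) : ∃ δ, E.potential κ δ n 0 = r := by
  have hpos : 0 < ∑ j ∈ Finset.range (n + 1), (E.arrivalProb / E.serviceProb) ^ j :=
    Finset.sum_pos (fun j _ ↦ pow_pos (div_pos E.arrivalProb_pos E.serviceProb_pos) j) (by simp)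
  refine ⟨(r - E.potential κ 0 n 0) /
    ∑ j ∈ Finset.range (n + 1), (E.arrivalProb / E.serviceProb) ^ j, ?_⟩
  conv_lhs => rw [potential]
  simp_rw [E.potentialIncrement_eq κ (_ / _)]
  rw [Finset.sum_add_distrib, ← Finset.sum_mul]
  simp only [Nat.sub_zero]
  rw [mul_div_cancel₀ _ hpos.ne']
  simp [potential]

/-- Conditioning on one event, for a general past `𝒢`: it serves both the threshold chain and the
customer. -/
lemma integral_ite_event {Ω : Type*} {𝒢 mΩ : MeasurableSpace Ω} {P : Measure Ω}
    [IsProbabilityMeasure P] {b : Ω → Bool} (hb : Measurable b)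
    (hlaw : P.map b = E.eventLaw) (hind : Indep 𝒢 (MeasurableSpace.comap b inferInstance) P)
    {Y Z : Ω → ℝ} (hY : Measurable[𝒢] Y) (hZ : Measurable[𝒢] Z)
    (hYi : Integrable Y P) (hZi : Integrable Z P) :
    ∫ ω, (if b ω then Y ω else Z ω) ∂P
      = E.arrivalProb * ∫ ω, Y ω ∂P + E.serviceProb * ∫ ω, Z ω ∂P := by
  have key (a : Bool) (X : Ω → ℝ) (hX : Measurable[𝒢] X) (hXi : Integrable X P) :
      ∫ ω, (b ⁻¹' {a}).indicator X ω ∂P = E.eventLaw.real {a} * ∫ ω, X ω ∂P := by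
    have hf : Measurable fun x : Bool ↦ ({a} : Set Bool).indicator (1 : Bool → ℝ) x :=
      measurable_from_top
    have hI : IndepFun X (fun ω ↦ ({a} : Set Bool).indicator (1 : Bool → ℝ) (b ω)) P := by
      rw [IndepFun_iff_Indep]
      refine indep_of_indep_of_le_left (indep_of_indep_of_le_right hind ?_) hX.comap_le
      rw [← measurable_iff_comap_le]
      exact hf.comp (comap_measurable b)
    have h := hI.integral_fun_mul_eq_mul_integral hXi.aestronglyMeasurable
      (hf.comp hb).aestronglyMeasurable
    have h2 : ∫ ω, ({a} : Set Bool).indicator (1 : Bool → ℝ) (b ω) ∂P = E.eventLaw.real {a} := by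
      rw [← hlaw, map_measureReal_apply hb (measurableSet_singleton a),
        ← integral_indicator_one (hb (measurableSet_singleton a))]
      rfl
    rw [h2, mul_comm] at h
    rw [← h]
    congr 1 with ω
    by_cases hω : b ω = a <;> simp [Set.indicator, hω]
  rw [← E.eventLaw_real_true, ← E.eventLaw_real_false, ← key true Y hY hYi, ← key false Z hZ hZi,
    ← integral_add (hYi.indicator (hb (measurableSet_singleton _)))
      (hZi.indicator (hb (measurableSet_singleton _)))]
  congr 1 with ω
  cases hω : b ω <;> simp [Set.indicator, hω]

end Environment

/-- The uniform bound makes the integral finite, so that `toReal` does not return its default value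
`0`. -/
lemma hasSum_measureReal_of_sum_range_le {Ω : Type*} [MeasurableSpace Ω] {P : Measure Ω}
    [IsProbabilityMeasure P] {A : ℕ → Set Ω} (hA : ∀ k, MeasurableSet (A k)) {C : ℝ}
    (hC : ∀ m, ∑ k ∈ Finset.range m, P.real (A k) ≤ C) :
    HasSum (fun k ↦ P.real (A k)) (∫⁻ ω, ∑' k, (A k).indicator 1 ω ∂P).toReal := by
  have hs : Summable fun k ↦ P.real (A k) :=
    summable_of_sum_range_le (fun _ ↦ measureReal_nonneg) hC
  rw [lintegral_tsum fun k ↦ (measurable_one.indicator (hA k)).aemeasurable]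
  simp_rw [lintegral_indicator_one (hA _)]
  rw [ENNReal.tsum_toReal_eq fun k ↦ measure_ne_top _ _]
  exact hs.hasSum

/-! ### Paths and history of the threshold chain -/

section Chain

variable {n : ℕ}

lemma thresholdChain_le (n : ℕ) (e : ℕ → Bool) (k : ℕ) : thresholdChain n e k ≤ n := by
  induction k with
  | zero => exact le_rfl
  | succ k ih =>
    rw [thresholdChain]
    split
    · exact min_le_right _ _
    · omega

/-- The event sequences along which the threshold chain has not yet reached `0`, nor come back to
`n`, after `k` events. -/
def chainAlive (n k : ℕ) : Set (ℕ → Bool) :=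
  {e | ∀ j, 1 ≤ j → j ≤ k → thresholdChain n e j ≠ 0 ∧ thresholdChain n e j ≠ n}

lemma chainAlive_zero (n : ℕ) : chainAlive n 0 = Set.univ := by
  ext e
  simp only [chainAlive, Set.mem_ofPred_eq, Set.mem_univ, iff_true]
  intro j h1 h2
  omega

lemma mem_chainAlive_succ {k : ℕ} {e : ℕ → Bool} :
    e ∈ chainAlive n (k + 1) ↔ e ∈ chainAlive n k ∧
      thresholdChain n e (k + 1) ≠ 0 ∧ thresholdChain n e (k + 1) ≠ n := by
  refine ⟨fun h ↦ ⟨fun j h1 h2 ↦ h j h1 (by omega), h (k + 1) (by omega) le_rfl⟩,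
    fun h j h1 h2 ↦ ?_⟩
  rcases Nat.lt_or_ge k j with hj | hj
  · obtain rfl : j = k + 1 := by omega
    exact h.2
  · exact h.1 j h1 hj

/-- The chain exits exactly at the event number `k + 1`, at the value `a`. -/
def chainExit (n a k : ℕ) : Set (ℕ → Bool) :=
  chainAlive n k ∩ {e | thresholdChain n e (k + 1) = a}

/-- The exit time counts the `k ≥ 0` that it exceeds; both sides are `⊤` if there is no exit. -/
lemma exitTime_eq_tsum (n : ℕ) (e : ℕ → Bool) :
    exitTime n e = ∑' k, (chainAlive n k).indicator 1 e := by
  classical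
  by_cases h : ∃ k, 1 ≤ k ∧ (thresholdChain n e k = 0 ∨ thresholdChain n e k = n)
  · have hK := Nat.find_spec h
    have hmin : ∀ j, 1 ≤ j ∧ (thresholdChain n e j = 0 ∨ thresholdChain n e j = n) →
      Nat.find h ≤ j := fun j hj ↦ Nat.find_min' h hj
    generalize Nat.find h = K at hK hmin
    have hal : ∀ k, e ∈ chainAlive n k ↔ k < K := by
      intro k
      constructor
      · intro hk
        by_contra hlt
        have := hk K hK.1 (by omega)
        tauto
      · intro hk j h1 h2
        have := mt (hmin j) (by omega)
        tauto
    rw [tsum_eq_sum (s := Finset.range K)]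
    · rw [Finset.sum_congr rfl (g := fun _ ↦ 1)]
      · simp only [Finset.sum_const, Finset.card_range, nsmul_eq_mul, mul_one]
        refine le_antisymm (iInf₂_le K hK) (le_iInf₂ fun k hk ↦ ?_)
        exact_mod_cast hmin k hk
      · intro k hk
        simp [(hal k).2 (Finset.mem_range.1 hk)]
    · intro k hk
      have : e ∉ chainAlive n k := by simpa [hal] using hk
      simp [this]
  · have hal : ∀ k, e ∈ chainAlive n k := fun k j h1 _ ↦ by
      have := not_exists.1 h j
      tauto
    have h1 : exitTime n e = ⊤ := by
      rw [exitTime, iInf₂_eq_top]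
      exact fun k hk ↦ (h ⟨k, hk⟩).elim
    rw [h1]
    simp [hal]

/-- The information carried by the first `k` events. -/
@[reducible]
def eventHistory (k : ℕ) : MeasurableSpace (ℕ → Bool) :=
  ⨆ j ∈ Set.Iio k, MeasurableSpace.comap (fun e : ℕ → Bool ↦ e j) inferInstance

lemma eventHistory_le (k : ℕ) : eventHistory k ≤ MeasurableSpace.pi :=
  iSup₂_le fun j _ ↦ (measurable_pi_apply j).comap_le

lemma eventHistory_mono : Monotone eventHistory := fun _ _ h ↦
  biSup_mono fun _ hj ↦ lt_of_lt_of_le hj h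

lemma measurable_eventHistory (k : ℕ) :
    Measurable[eventHistory (k + 1)] fun e : ℕ → Bool ↦ e k := by
  rw [measurable_iff_comap_le]
  exact le_iSup₂_of_le k (Nat.lt_succ_self k) le_rfl

lemma measurable_thresholdChain (n k : ℕ) :
    Measurable[eventHistory k] fun e ↦ thresholdChain n e k := by
  induction k with
  | zero => exact measurable_const
  | succ k ih =>
    have ih' := ih.mono (eventHistory_mono k.le_succ) le_rfl
    simp only [thresholdChain]
    refine Measurable.ite ?_ ?_ ?_
    · exact measurable_eventHistory k (measurableSet_singleton true)
    · exact (measurable_from_top (f := fun y : ℕ ↦ min (y + 1) n)).comp ih'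
    · exact (measurable_from_top (f := fun y : ℕ ↦ y - 1)).comp ih'

lemma measurableSet_chainAlive (n k : ℕ) : MeasurableSet[eventHistory k] (chainAlive n k) := by
  induction k with
  | zero => rw [chainAlive_zero]; exact MeasurableSet.univ
  | succ k ih =>
    have : chainAlive n (k + 1) =
        chainAlive n k ∩ (fun e ↦ thresholdChain n e (k + 1)) ⁻¹' {y | y ≠ 0 ∧ y ≠ n} := by
      ext e
      exact mem_chainAlive_succ
    rw [this]
    exact (eventHistory_mono k.le_succ _ ih).inter
      (measurable_thresholdChain n (k + 1) (MeasurableSet.of_discrete))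

lemma measurableSet_chainExit (n a k : ℕ) : MeasurableSet (chainExit n a k) :=
  (eventHistory_le k _ (measurableSet_chainAlive n k)).inter
    (eventHistory_le (k + 1) _
      (measurable_thresholdChain n (k + 1) (measurableSet_singleton a)))

lemma integrable_indicator_chainAlive {μ : Measure (ℕ → Bool)} [IsProbabilityMeasure μ]
    (g : ℕ → ℝ) (n k l : ℕ) :
    Integrable ((chainAlive n k).indicator fun e ↦ g (thresholdChain n e l)) μ := by
  refine Integrable.indicator ?_ (eventHistory_le k _ (measurableSet_chainAlive n k))
  refine Integrable.of_bound (C := ∑ i ∈ Finset.range (n + 1), |g i|) ?_ (.of_forall fun e ↦ ?_)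
  · exact ((measurable_from_top (f := g)).comp
      ((measurable_thresholdChain n l).mono (eventHistory_le l) le_rfl)).aestronglyMeasurable
  · exact Finset.single_le_sum (f := fun i ↦ |g i|) (fun i _ ↦ abs_nonneg _)
      (Finset.mem_range.2 (Nat.lt_succ_of_le (thresholdChain_le n e l)))

end Chain

/-! ### Optional stopping for the threshold chain -/

namespace Environment

variable (E : Environment) {n : ℕ}

instance : IsProbabilityMeasure E.eventSeqLaw := by
  unfold eventSeqLaw; infer_instance

lemma map_eventSeqLaw (k : ℕ) : E.eventSeqLaw.map (fun e ↦ e k) = E.eventLaw :=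
  Measure.infinitePi_map_eval _ k

lemma indep_eventHistory (k : ℕ) :
    Indep (eventHistory k) (MeasurableSpace.comap (fun e : ℕ → Bool ↦ e k) inferInstance)
      E.eventSeqLaw := by
  have h : iIndepFun (fun j (e : ℕ → Bool) ↦ e j) E.eventSeqLaw :=
    iIndepFun_infinitePi (X := fun _ b ↦ b) (fun _ ↦ measurable_id)
  have := indep_iSup_of_disjoint (fun j ↦ (measurable_pi_apply j).comap_le)
    ((iIndepFun_iff_iIndep _ _ _).1 h)
    (S := Set.Iio k) (T := {k}) (by simp)
  simpa [eventHistory] using this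

/-- The expected value of `g` at the chain after `k` events, on the event that it is alive. -/
noncomputable def aliveMean (g : ℕ → ℝ) (n k : ℕ) : ℝ :=
  ∫ e, (chainAlive n k).indicator (fun e ↦ g (thresholdChain n e k)) e ∂E.eventSeqLaw

lemma aliveMean_zero (g : ℕ → ℝ) (n : ℕ) : E.aliveMean g n 0 = g n := by
  simp [aliveMean, chainAlive_zero, thresholdChain]

lemma indicator_chainAlive_succ (hn : 1 ≤ n) (g : ℕ → ℝ) (k : ℕ) (e : ℕ → Bool) :
    (chainAlive n k).indicator (fun e ↦ g (thresholdChain n e (k + 1))) e =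
      (chainAlive n (k + 1)).indicator (fun e ↦ g (thresholdChain n e (k + 1))) e +
      (g 0 * (chainExit n 0 k).indicator 1 e + g n * (chainExit n n k).indicator 1 e) := by
  by_cases hk : e ∈ chainAlive n k
  · by_cases h0 : thresholdChain n e (k + 1) = 0
    · have : thresholdChain n e (k + 1) ≠ n := by omega
      simp [Set.indicator, chainExit, mem_chainAlive_succ, hk, h0, show ¬ 0 = n by omega]
    · by_cases h1 : thresholdChain n e (k + 1) = n
      · simp [Set.indicator, chainExit, mem_chainAlive_succ, hk, h1, show ¬ n = 0 by omega]
      · simp [Set.indicator, chainExit, mem_chainAlive_succ, hk, h1, h0]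
  · simp [Set.indicator, chainExit, mem_chainAlive_succ, hk]

lemma aliveMean_succ (hn : 1 ≤ n) (g : ℕ → ℝ) (k : ℕ) :
    E.aliveMean g n (k + 1) + (g 0 * E.eventSeqLaw.real (chainExit n 0 k) +
        g n * E.eventSeqLaw.real (chainExit n n k)) =
      ∫ e, (chainAlive n k).indicator (fun e ↦
        E.arrivalProb * g (min (thresholdChain n e k + 1) n) +
          E.serviceProb * g (thresholdChain n e k - 1)) e ∂E.eventSeqLaw := by
  have hA := measurableSet_chainAlive n k
  have hm (f : ℕ → ℝ) : Measurable[eventHistory k]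
      ((chainAlive n k).indicator fun e ↦ f (thresholdChain n e k)) :=
    ((measurable_from_top (f := f)).comp (measurable_thresholdChain n k)).indicator hA
  have hi (f : ℕ → ℝ) := integrable_indicator_chainAlive (μ := E.eventSeqLaw) f n k k
  have hx (a : ℕ) : Integrable ((chainExit n a k).indicator (1 : (ℕ → Bool) → ℝ)) E.eventSeqLaw :=
    (integrable_const (1 : ℝ)).indicator (measurableSet_chainExit n a k)
  have key := E.integral_ite_event (measurable_pi_apply k) (E.map_eventSeqLaw k)
    (E.indep_eventHistory k) (hm fun y ↦ g (min (y + 1) n)) (hm fun y ↦ g (y - 1))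
    (hi fun y ↦ g (min (y + 1) n)) (hi fun y ↦ g (y - 1))
  rw [← integral_const_mul, ← integral_const_mul, ← integral_add
    ((hi fun y ↦ g (min (y + 1) n)).const_mul _) ((hi fun y ↦ g (y - 1)).const_mul _)] at key
  rw [aliveMean, ← integral_indicator_one (measurableSet_chainExit n 0 k),
    ← integral_indicator_one (measurableSet_chainExit n n k), ← integral_const_mul,
    ← integral_const_mul, ← integral_add ((hx _).const_mul _) ((hx _).const_mul _),
    ← integral_add (integrable_indicator_chainAlive g n (k + 1) (k + 1))
      (show Integrable (fun e ↦ g 0 * (chainExit n 0 k).indicator 1 e +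
        g n * (chainExit n n k).indicator 1 e) _ from
          ((hx 0).const_mul _).add ((hx n).const_mul _))]
  simp_rw [← indicator_chainAlive_succ hn]
  refine Eq.trans ?_ (key.trans ?_)
  · congr 1 with e
    by_cases h : e ∈ chainAlive n k <;> cases he : e k <;> simp [h, he, thresholdChain]
  · congr 1 with e
    by_cases h : e ∈ chainAlive n k <;> simp [h]

lemma measureReal_chainAlive_succ (hn : 1 ≤ n) (k : ℕ) :
    E.eventSeqLaw.real (chainAlive n (k + 1)) + (E.eventSeqLaw.real (chainExit n 0 k) +
      E.eventSeqLaw.real (chainExit n n k)) = E.eventSeqLaw.real (chainAlive n k) := by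
  have h (l : ℕ) := integral_indicator_one (μ := E.eventSeqLaw)
    (eventHistory_le l _ (measurableSet_chainAlive n l))
  have := E.aliveMean_succ hn (fun _ ↦ 1) k
  rw [← h, ← h]
  simpa [aliveMean, E.arrivalProb_add_serviceProb, Pi.one_def] using this

/-- After the first step an alive chain is strictly between `0` and `n`, where the cap at `n` has no
effect and `potential_step` applies. At `k = 0` the chain is at `n`, and an arrival leaves it at
value `δ` in place of `V (n + 1) = 0`: this is the correction term. -/
lemma aliveMean_potential_succ (hn : 1 ≤ n) (κ δ : ℝ) (k : ℕ) :
    E.aliveMean (E.potential κ δ n) n (k + 1) +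
        (E.potential κ δ n 0 * E.eventSeqLaw.real (chainExit n 0 k) +
        δ * E.eventSeqLaw.real (chainExit n n k)) =
      E.aliveMean (E.potential κ δ n) n k + κ * E.eventSeqLaw.real (chainAlive n k) +
        if k = 0 then E.arrivalProb * δ else 0 := by
  have h := E.aliveMean_succ hn (E.potential κ δ n) k
  rw [potential_self] at h
  rw [h]
  rcases Nat.eq_zero_or_pos k with rfl | hk
  · have := E.potential_step κ δ hn le_rfl
    simp only [chainAlive_zero, thresholdChain, aliveMean_zero, potential_self,
      potential_succ_self] at this ⊢
    simp [potential_self]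
    linear_combination this
  · rw [if_neg (by omega), add_zero, aliveMean,
      ← integral_indicator_one (eventHistory_le k _ (measurableSet_chainAlive n k)),
      ← integral_const_mul, ← integral_add (integrable_indicator_chainAlive _ n k k)]
    · congr 1 with e
      by_cases he : e ∈ chainAlive n k
      · obtain ⟨h0, h1⟩ := he k hk le_rfl
        have h2 := thresholdChain_le n e k
        have h3 : min (thresholdChain n e k + 1) n = thresholdChain n e k + 1 :=
          min_eq_left (by omega)
        simp only [he, Set.indicator_of_mem, h3, Pi.one_apply, mul_one]
        exact E.potential_step κ δ (by omega) h2
      · simp [he]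
    · exact ((integrable_const (1 : ℝ)).indicator
        (eventHistory_le k _ (measurableSet_chainAlive n k))).const_mul κ

lemma abs_aliveMean_le {g : ℕ → ℝ} {C : ℝ} (hC : ∀ i ≤ n, |g i| ≤ C) (k : ℕ) :
    |E.aliveMean g n k| ≤ C * E.eventSeqLaw.real (chainAlive n k) := by
  have hA := eventHistory_le k _ (measurableSet_chainAlive n k)
  rw [aliveMean, integral_indicator hA]
  exact norm_setIntegral_le_of_norm_le_const (f := fun e ↦ g (thresholdChain n e k))
    (measure_lt_top _ _) fun e _ ↦ hC _ (thresholdChain_le n e k)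

/-- With `κ = 1` each alive round raises the mean potential by one, while the potential never
exceeds `V 0`; with `δ = 0` the correction at the first step vanishes. -/
lemma sum_measureReal_chainAlive_le (hn : 1 ≤ n) (m : ℕ) :
    ∑ k ∈ Finset.range m, E.eventSeqLaw.real (chainAlive n k) ≤ E.potential 1 0 n 0 := by
  have hW := E.potential_nonneg zero_le_one le_rfl n
  have hanti := E.potential_antitone zero_le_one le_rfl n
  -- Exits at `n` are credited with `V 0` as well, so only the total exit probability enters.
  have key : ∑ k ∈ Finset.range m, E.eventSeqLaw.real (chainAlive n k) ≤
      E.aliveMean (E.potential 1 0 n) n m +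
        E.potential 1 0 n 0 * (1 - E.eventSeqLaw.real (chainAlive n m)) := by
    induction m with
    | zero => simp [aliveMean_zero, potential_self, chainAlive_zero]
    | succ m ih =>
      rw [Finset.sum_range_succ]
      have h1 := E.aliveMean_potential_succ hn 1 0 m
      have h2 := E.measureReal_chainAlive_succ hn m
      have h3 : 0 ≤ E.potential 1 0 n 0 * E.eventSeqLaw.real (chainExit n n m) :=
        mul_nonneg (hW 0) measureReal_nonneg
      have h4 : (if m = 0 then E.arrivalProb * 0 else 0) = 0 := by split <;> simp
      rw [h4] at h1
      have h5 := congrArg (E.potential 1 0 n 0 * ·) h2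
      simp only [mul_add] at h5
      linarith
  have h1 := E.abs_aliveMean_le (g := E.potential 1 0 n) (C := E.potential 1 0 n 0) (n := n)
    (fun i _ ↦ by rw [abs_of_nonneg (hW i)]; exact hanti (Nat.zero_le i)) m
  have h2 := le_abs_self (E.aliveMean (E.potential 1 0 n) n m)
  linarith

lemma hasSum_chainAlive (hn : 1 ≤ n) :
    HasSum (fun k ↦ E.eventSeqLaw.real (chainAlive n k)) (E.T n) := by
  rw [T]
  simp_rw [exitTime_eq_tsum]
  exact hasSum_measureReal_of_sum_range_le
    (fun k ↦ eventHistory_le k _ (measurableSet_chainAlive n k))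
    (E.sum_measureReal_chainAlive_le hn)

lemma hasSum_chainExit_zero (n : ℕ) :
    HasSum (fun k ↦ E.eventSeqLaw.real (chainExit n 0 k)) (E.theta n) := by
  have hset : {e | ∃ k, 1 ≤ k ∧ thresholdChain n e k = 0 ∧
      ∀ j, 1 ≤ j → j < k → thresholdChain n e j ≠ n} = ⋃ k, chainExit n 0 k := by
    classical
    ext e
    simp only [Set.mem_ofPred_eq, Set.mem_iUnion]
    constructor
    · intro h
      -- The definition of `theta` does not forbid earlier visits to `0`; the least `k` does.
      obtain ⟨h1, h2, h3⟩ := Nat.find_spec h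
      have hmin := fun j hj ↦ Nat.find_min h (m := j) hj
      generalize Nat.find h = K at h1 h2 h3 hmin
      obtain ⟨K, rfl⟩ := Nat.exists_eq_add_of_le' h1
      refine ⟨K, fun j hj1 hj2 ↦ ⟨fun h0 ↦ ?_, h3 j hj1 (by omega)⟩, h2⟩
      exact hmin j (by omega) ⟨hj1, h0, fun i hi1 hi2 ↦ h3 i hi1 (by omega)⟩
    · rintro ⟨k, hk, h0⟩
      exact ⟨k + 1, by omega, h0, fun j hj1 hj2 ↦ (hk j hj1 (by omega)).2⟩
  have hdisj : Pairwise (Function.onFun Disjoint (chainExit n 0)) := by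
    refine (pairwise_disjoint_on _).2 fun i j hij ↦ Set.disjoint_left.2 fun e hi hj ↦ ?_
    exact (hj.1 (i + 1) (by omega) hij).1 hi.2
  rw [theta, hset]
  have h := measure_iUnion (μ := E.eventSeqLaw) hdisj fun k ↦ measurableSet_chainExit n 0 k
  rw [Measure.real, h, ENNReal.tsum_toReal_eq fun k ↦ measure_ne_top _ _]
  exact (ENNReal.summable_toReal (h ▸ measure_ne_top _ _)).hasSum

-- Summing the one-step balances up to time `m` and letting `m → ∞` gives `r θ + δ (1 - θ) = δ + κ T
-- + arrivalProb * δ`.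
open Filter Topology in
lemma D_eq (hn : 1 ≤ n) {δ : ℝ} (hδ : E.potential (E.c / (E.lam + E.mu)) δ n 0 = E.r) :
    E.D n = δ * (E.theta n + E.arrivalProb) := by
  set κ := E.c / (E.lam + E.mu) with hκ
  have hT := E.hasSum_chainAlive hn
  have hA0 := hT.summable.tendsto_atTop_zero
  have hT' := hT.tendsto_sum_nat
  have hθ := (E.hasSum_chainExit_zero n).tendsto_sum_nat
  -- The factor of `δ` on the left is the probability of having exited at `n`, eliminated through
  -- conservation of mass.
  have key (m : ℕ) : E.aliveMean (E.potential κ δ n) n (m + 1) +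
      E.r * ∑ k ∈ Finset.range (m + 1), E.eventSeqLaw.real (chainExit n 0 k) +
      δ * (1 - E.eventSeqLaw.real (chainAlive n (m + 1)) -
        ∑ k ∈ Finset.range (m + 1), E.eventSeqLaw.real (chainExit n 0 k)) =
      δ + κ * ∑ k ∈ Finset.range (m + 1), E.eventSeqLaw.real (chainAlive n k) +
        E.arrivalProb * δ := by
    induction m with
    | zero =>
      have h1 := E.aliveMean_potential_succ hn κ δ 0
      have h2 := E.measureReal_chainAlive_succ hn 0
      simp [aliveMean_zero, potential_self, hδ, chainAlive_zero] at h1 h2 ⊢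
      linear_combination h1 - δ * h2
    | succ m ih =>
      have h1 := E.aliveMean_potential_succ hn κ δ (m + 1)
      have h2 := E.measureReal_chainAlive_succ hn (m + 1)
      rw [if_neg (Nat.succ_ne_zero m), hδ] at h1
      rw [Finset.sum_range_succ _ (m + 1), Finset.sum_range_succ _ (m + 1)]
      linear_combination ih + h1 - δ * h2
  have hu : Tendsto (fun m ↦ E.aliveMean (E.potential κ δ n) n m) atTop (𝓝 0) := by
    refine squeeze_zero_norm (fun m ↦ E.abs_aliveMean_le (n := n)
      (C := ∑ i ∈ Finset.range (n + 1), |E.potential κ δ n i|) (fun i hi ↦ ?_) m) ?_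
    · exact Finset.single_le_sum (f := fun i ↦ |E.potential κ δ n i|)
        (fun i _ ↦ abs_nonneg _) (Finset.mem_range.2 (Nat.lt_succ_of_le hi))
    · simpa using hA0.const_mul (∑ i ∈ Finset.range (n + 1), |E.potential κ δ n i|)
  have sh {f : ℕ → ℝ} {a : ℝ} (h : Tendsto f atTop (𝓝 a)) :
      Tendsto (fun m ↦ f (m + 1)) atTop (𝓝 a) := (tendsto_add_atTop_iff_nat 1).2 h
  have hl := ((sh hu).add ((sh hθ).const_mul E.r)).add
    ((((sh hA0).const_sub 1).sub (sh hθ)).const_mul δ)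
  have hr := (((sh hT').const_mul κ).const_add δ).add_const (E.arrivalProb * δ)
  have := tendsto_nhds_unique hl (hr.congr fun m ↦ (key m).symm)
  rw [D, ← hκ]
  linear_combination this

lemma theta_add_arrivalProb_pos (n : ℕ) : 0 < E.theta n + E.arrivalProb :=
  add_pos_of_nonneg_of_pos measureReal_nonneg E.arrivalProb_pos

end Environment

/-! ### Mean length of a round -/

lemma lintegral_ofReal_expMeasure {s : ℝ} (hs : 0 < s) :
    ∫⁻ x, ENNReal.ofReal x ∂(expMeasure s) = ENNReal.ofReal s⁻¹ := by
  rw [expMeasure, gammaMeasure, lintegral_withDensity_eq_lintegral_mul₀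
    (f := gammaPDF 1 s) (by unfold gammaPDF; fun_prop) (by fun_prop)]
  -- `x` times the exponential density is `s⁻¹` times the Gamma density of shape `2`, whose mass is
  -- one.
  have h : ∀ x, (gammaPDF 1 s * fun x ↦ ENNReal.ofReal x) x =
      ENNReal.ofReal s⁻¹ * gammaPDF 2 s x := by
    intro x
    simp only [Pi.mul_apply, gammaPDF, gammaPDFReal]
    rcases lt_or_ge x 0 with hx | hx
    · simp [hx.not_ge]
    · rw [if_pos hx, if_pos hx, ← ENNReal.ofReal_mul' hx, ← ENNReal.ofReal_mul (by positivity)]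
      congr 1
      norm_num [Real.Gamma_two]
      field_simp
  simp_rw [h]
  rw [lintegral_const_mul _ (by unfold gammaPDF; fun_prop),
    lintegral_gammaPDF_eq_one two_pos hs, mul_one]

/-! ### Drift of the customer's value along a path -/

namespace Situation

variable {R : Regime.{u}}

/-- The value of a situation, for a given value `V p` of each position `p`, the value `V 0` of
having been served, and the value `0` of having reneged. -/
def value (V : ℕ → ℝ) : Situation R → ℝ
  | inSystem _ p => V p
  | served => V 0
  | reneged => 0

/-- The customer is not in the system, or her position is between `1` and `n`. -/
def InRange (n : ℕ) : Situation R → Prop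
  | inSystem _ p => 1 ≤ p ∧ p ≤ n
  | served => True
  | reneged => True

lemma value_nonneg {V : ℕ → ℝ} (hV : ∀ p, 0 ≤ V p) : ∀ s : Situation R, 0 ≤ s.value V
  | inSystem _ p => hV p
  | served => hV 0
  | reneged => le_rfl

lemma value_le {V : ℕ → ℝ} (hV : ∀ p, 0 ≤ V p) (hanti : Antitone V) :
    ∀ s : Situation R, s.value V ≤ V 0
  | inSystem _ p => hanti (Nat.zero_le p)
  | served => le_rfl
  | reneged => hV 0

/-- Reneging of others can only decrease her position. -/
lemma value_le_value_afterOpponents {V : ℕ → ℝ} (hanti : Antitone V) (I : Finset ℕ) :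
    ∀ s : Situation R, s.value V ≤ (afterOpponents I s).value V
  | inSystem _ _ => hanti (Nat.sub_le _ _)
  | served => le_rfl
  | reneged => le_rfl

lemma isPresent_afterOpponents (I : Finset ℕ) :
    ∀ s : Situation R, (afterOpponents I s).IsPresent ↔ s.IsPresent
  | inSystem _ _ => Iff.rfl
  | served => Iff.rfl
  | reneged => Iff.rfl

lemma inRange_afterOpponents {n : ℕ} (I : Finset ℕ) :
    ∀ {s : Situation R}, s.InRange n → (afterOpponents I s).InRange n
  | inSystem x p, ⟨h1, h2⟩ => by
    -- At most `p - 1` customers are ahead, so her position stays at least `1`.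
    have hcard : ((((I ∩ Finset.Icc 1 (R.size x)).erase p).filter (· < p)).card) ≤ p - 1 := by
      rw [← Nat.card_Ico 1 p]
      refine Finset.card_le_card fun i hi ↦ ?_
      simp only [Finset.mem_filter, Finset.mem_erase, Finset.mem_inter, Finset.mem_Icc] at hi
      exact Finset.mem_Ico.2 ⟨hi.1.2.2.1, hi.2⟩
    simp only [afterOpponents, InRange]
    omega
  | served, _ => trivial
  | reneged, _ => trivial

lemma inRange_afterDecision_afterEvent {n : ℕ} (a : Bool) :
    ∀ {s : Situation R}, s.InRange n → (afterDecision n (afterEvent a s)).InRange n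
  | inSystem x p, ⟨h1, h2⟩ => by
    cases a
    · by_cases hp : p = 1
      · simp [afterEvent, afterDecision, InRange, hp]
      · simp only [afterEvent, hp, afterDecision, if_false, Bool.false_eq_true]
        rw [if_pos (by omega)]
        exact ⟨by omega, by omega⟩
    · simp only [afterEvent, if_true, afterDecision]
      generalize hq : (if R.position x ≤ p then p + 1 else p) = q
      have hq1 : 1 ≤ q := by split at hq <;> omega
      by_cases h : q ≤ n
      · rw [if_pos h]
        exact ⟨hq1, h⟩
      · rw [if_neg h]
        trivial
  | served, _ => trivial
  | reneged, _ => trivial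

lemma inRange_run {n : ℕ} (hn : 1 ≤ n) (x₀ : R.State) (e : ℕ → Bool) (I : ℕ → Finset ℕ)
    (k : ℕ) : (run n x₀ e I k).InRange n := by
  induction k with
  | zero =>
    refine inRange_afterOpponents _ ?_
    simp [afterDecision, InRange, hn]
  | succ k ih => exact inRange_afterOpponents _ (inRange_afterDecision_afterEvent _ ih)

lemma run_succ_eq_served {n : ℕ} {x₀ : R.State} {e : ℕ → Bool} {I : ℕ → Finset ℕ} {k : ℕ}
    (h : run n x₀ e I k = served) : run n x₀ e I (k + 1) = served := by
  rw [run, h]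
  rfl

/-- The drift of the value along one event, before the opponents renege, is at least `κ` while
the customer is in the system. -/
lemma value_add_le (E : Environment) {κ δ : ℝ} (hκ : 0 ≤ κ) (hδ : 0 ≤ δ) {n : ℕ}
    {s : Situation R} (hs : s.InRange n) :
    s.value (E.potential κ δ n) + κ * {s : Situation R | s.IsPresent}.indicator 1 s ≤
      E.arrivalProb * (afterDecision n (afterEvent true s)).value (E.potential κ δ n) +
      E.serviceProb * (afterDecision n (afterEvent false s)).value (E.potential κ δ n) := by
  have hsum := E.arrivalProb_add_serviceProb
  match s, hs with
  | served, _ =>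
    simp [IsPresent, afterEvent, afterDecision, ← add_mul, hsum]
  | reneged, _ => simp [IsPresent, afterEvent, afterDecision, value]
  | inSystem x p, ⟨h1, h2⟩ =>
    have hstep := E.potential_step κ δ h1 h2
    have hs : (afterDecision n (afterEvent false (inSystem x p))).value (E.potential κ δ n) =
        E.potential κ δ n (p - 1) := by
      by_cases hp : p = 1
      · simp [afterEvent, afterDecision, value, hp]
      · simp only [afterEvent, hp, afterDecision, if_false, Bool.false_eq_true]
        rw [if_pos (by omega)]
        rfl
    -- The only inequality: an arrival placed behind leaves her at `p`, worth at least `V (p + 1)`.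
    -- If she is pushed beyond `n` she reneges, and the value `0` is exactly `V (n + 1)`.
    have ha : E.potential κ δ n (p + 1) ≤
        (afterDecision n (afterEvent true (inSystem x p))).value (E.potential κ δ n) := by
      simp only [afterEvent, if_true, afterDecision]
      by_cases hx : R.position x ≤ p
      · rw [if_pos hx]
        by_cases hp : p + 1 ≤ n
        · rw [if_pos hp]
          rfl
        · rw [if_neg hp, show p = n by omega, E.potential_succ_self]
          rfl
      · rw [if_neg hx, if_pos h2]
        exact E.potential_antitone hκ hδ n p.le_succ
    rw [hs]
    have := mul_le_mul_of_nonneg_left ha E.arrivalProb_pos.le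
    have hp : {s : Situation R | s.IsPresent}.indicator (1 : Situation R → ℝ)
        (inSystem x p) = 1 :=
      Set.indicator_of_mem (show inSystem x p ∈ {s : Situation R | s.IsPresent} from trivial) 1
    rw [hp, show (inSystem x p).value _ = E.potential κ δ n p from rfl]
    linarith

end Situation

/-! ### The customer's value as a submartingale -/

section Customer

variable {E : Environment} {R : Regime.{u}} {Ω : Type v} [mΩ : MeasurableSpace Ω] {P : Measure Ω}
  {ℱ : Filtration ℕ mΩ}

/-- What is known in round `k` before the event that ends it: the past and the length of the
round. -/
@[reducible]
def EventProcess.roundHistory (N : EventProcess E P ℱ) (k : ℕ) : MeasurableSpace Ω :=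
  ℱ k ⊔ MeasurableSpace.comap (N.duration k) inferInstance

lemma EventProcess.roundHistory_le (N : EventProcess E P ℱ) (k : ℕ) :
    N.roundHistory k ≤ ℱ (k + 1) :=
  sup_le (ℱ.mono k.le_succ) (N.measurable_duration k).comap_le

lemma OpponentBehavior.measurableSet_leaves_eq {N : EventProcess E P ℱ} (S : OpponentBehavior N)
    (k : ℕ) (J : Finset ℕ) : MeasurableSet[N.roundHistory k] {ω | S.leaves k ω = J} := by
  have : {ω | S.leaves k ω = J} = ⋂ i, {ω | i ∈ S.leaves k ω ↔ i ∈ J} := by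
    ext ω
    simp [Finset.ext_iff]
  rw [this]
  refine MeasurableSet.iInter fun i ↦ ?_
  by_cases hi : i ∈ J
  · simpa [hi] using S.measurableSet_leaves k i
  · simp only [hi, iff_false]
    exact (S.measurableSet_leaves k i).compl

/-- The situation in round `k + 1`, before the opponents renege. -/
def situationBefore (R : Regime.{u}) (N : EventProcess E P ℱ) (S : OpponentBehavior N) (n : ℕ)
    (x₀ : R.State) (ω : Ω) (k : ℕ) : Situation R :=
  Situation.afterDecision n (Situation.afterEvent (N.isArrival k ω) (situation R N S n x₀ ω k))

lemma situation_succ (N : EventProcess E P ℱ) (S : OpponentBehavior N) (n : ℕ)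
    (x₀ : R.State) (ω : Ω) (k : ℕ) : situation R N S n x₀ ω (k + 1) =
      Situation.afterOpponents (S.leaves (k + 1) ω) (situationBefore R N S n x₀ ω k) := rfl

variable (N : EventProcess E P ℱ) (S : OpponentBehavior N) (n : ℕ) (x₀ : R.State)

lemma measurableSet_situationBefore {k : ℕ}
    (h : ∀ B : Set (Situation R), MeasurableSet[N.roundHistory k] {ω | situation R N S n x₀ ω k ∈ B})
    (B : Set (Situation R)) :
    MeasurableSet[ℱ (k + 1)] {ω | situationBefore R N S n x₀ ω k ∈ B} := by
  have : {ω | situationBefore R N S n x₀ ω k ∈ B} = ⋃ a, (N.isArrival k ⁻¹' {a} ∩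
      {ω | situation R N S n x₀ ω k ∈
        {s | Situation.afterDecision n (Situation.afterEvent a s) ∈ B}}) := by
    ext ω
    simp [situationBefore]
  rw [this]
  exact MeasurableSet.iUnion fun a ↦
    (N.measurable_isArrival k (measurableSet_singleton a)).inter (N.roundHistory_le k _ (h _))

/-- Arbitrary sets `B` are allowed, with no measurable structure on the states: the situation
depends only on finitely many event types and finite sets of positions, which take countably many
values. -/
lemma measurableSet_situation (k : ℕ) (B : Set (Situation R)) :
    MeasurableSet[N.roundHistory k] {ω | situation R N S n x₀ ω k ∈ B} := by
  induction k generalizing B with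
  | zero =>
    have : {ω | situation R N S n x₀ ω 0 ∈ B} = ⋃ J, ({ω | S.leaves 0 ω = J} ∩
        {_ω | Situation.afterOpponents J
          (Situation.afterDecision n (Situation.inSystem x₀ n)) ∈ B}) := by
      ext ω
      simp [situation, Situation.run]
    rw [this]
    exact MeasurableSet.iUnion fun J ↦
      (S.measurableSet_leaves_eq 0 J).inter (MeasurableSet.const _)
  | succ k ih =>
    have : {ω | situation R N S n x₀ ω (k + 1) ∈ B} = ⋃ J, ({ω | S.leaves (k + 1) ω = J} ∩
        {ω | situationBefore R N S n x₀ ω k ∈ {s | Situation.afterOpponents J s ∈ B}}) := by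
      ext ω
      simp [situation_succ]
    rw [this]
    exact MeasurableSet.iUnion fun J ↦ (S.measurableSet_leaves_eq (k + 1) J).inter
      (le_sup_left (a := ℱ (k + 1)) _ (measurableSet_situationBefore N S n x₀ ih _))

/-- The event that the customer is in the system in round `k`. -/
def presentSet (k : ℕ) : Set Ω := {ω | (situation R N S n x₀ ω k).IsPresent}

/-- The event that the customer has been served by round `k`. -/
def servedSet (k : ℕ) : Set Ω := {ω | situation R N S n x₀ ω k = Situation.served}

/-- Opponents reneging in round `k` may react to its length, but they do not affect her presence in
that round. Hence presence is known at the start of the round and is independent of its length. -/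
lemma measurableSet_presentSet (k : ℕ) : MeasurableSet[ℱ k] (presentSet N S n x₀ k) := by
  cases k with
  | zero =>
    have : presentSet N S n x₀ 0 =
        {_ω | (Situation.afterDecision n (Situation.inSystem x₀ n)).IsPresent} := by
      ext ω
      exact Situation.isPresent_afterOpponents _ _
    rw [this]
    exact MeasurableSet.const _
  | succ k =>
    have : presentSet N S n x₀ (k + 1) =
        {ω | situationBefore R N S n x₀ ω k ∈ {s | s.IsPresent}} := by
      ext ω
      exact Situation.isPresent_afterOpponents _ _
    rw [this]
    exact measurableSet_situationBefore N S n x₀ (measurableSet_situation N S n x₀ k) _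

lemma measurableSet_servedSet (k : ℕ) : MeasurableSet (servedSet N S n x₀ k) :=
  (N.roundHistory_le k).trans (ℱ.le _) _ (measurableSet_situation N S n x₀ k {s | s = .served})

lemma measurable_situation_comp (k : ℕ) (f : Situation R → ℝ) :
    Measurable[N.roundHistory k] fun ω ↦ f (situation R N S n x₀ ω k) :=
  fun B _ ↦ measurableSet_situation N S n x₀ k (f ⁻¹' B)

lemma integrable_situation_comp [IsFiniteMeasure P] (k : ℕ) {f : Situation R → ℝ} {C : ℝ}
    (h0 : ∀ s, 0 ≤ f s) (hC : ∀ s, f s ≤ C) :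
    Integrable (fun ω ↦ f (situation R N S n x₀ ω k)) P := by
  refine Integrable.of_bound (C := C) ?_ (.of_forall fun ω ↦ ?_)
  · exact ((measurable_situation_comp N S n x₀ k f).mono
      ((N.roundHistory_le k).trans (ℱ.le _)) le_rfl).aestronglyMeasurable
  · rw [Real.norm_of_nonneg (h0 _)]
    exact hC _

lemma sojournTime_eq (ω : Ω) : sojournTime R N S n x₀ ω =
    ∑' k, (presentSet N S n x₀ k).indicator (1 : Ω → ℝ≥0∞) ω * ENNReal.ofReal (N.duration k ω) := by
  refine tsum_congr fun k ↦ ?_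
  by_cases h : ω ∈ presentSet N S n x₀ k
  · rw [if_pos (show (situation R N S n x₀ ω k).IsPresent from h), Set.indicator_of_mem h,
      Pi.one_apply, one_mul]
  · rw [if_neg (show ¬ (situation R N S n x₀ ω k).IsPresent from h),
      Set.indicator_of_notMem h, zero_mul]

variable [IsProbabilityMeasure P]

/-- The expected value of the situation in round `k`. -/
noncomputable def meanValue (V : ℕ → ℝ) (k : ℕ) : ℝ :=
  ∫ ω, (situation R N S n x₀ ω k).value V ∂P

variable {n}

lemma meanValue_add_le (hn : 1 ≤ n) {κ δ : ℝ} (hκ : 0 ≤ κ) (hδ : 0 ≤ δ) (k : ℕ) :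
    meanValue N S n x₀ (E.potential κ δ n) k + κ * P.real (presentSet N S n x₀ k) ≤
      meanValue N S n x₀ (E.potential κ δ n) (k + 1) := by
  classical
  set V := E.potential κ δ n with hVdef
  have hV : ∀ p, 0 ≤ V p := E.potential_nonneg hκ hδ n
  have hanti : Antitone V := E.potential_antitone hκ hδ n
  have hpm : MeasurableSet (presentSet N S n x₀ k) := ℱ.le k _ (measurableSet_presentSet N S n x₀ k)
  let f (a : Bool) (s : Situation R) : ℝ :=
    (Situation.afterDecision n (Situation.afterEvent a s)).value V
  have hi (a : Bool) : Integrable (fun ω ↦ f a (situation R N S n x₀ ω k)) P :=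
    integrable_situation_comp N S n x₀ k (fun s ↦ Situation.value_nonneg hV _)
      (fun s ↦ Situation.value_le hV hanti _)
  have hv (k : ℕ) : Integrable (fun ω ↦ (situation R N S n x₀ ω k).value V) P :=
    integrable_situation_comp N S n x₀ k (Situation.value_nonneg hV)
      (Situation.value_le hV hanti)
  have hp : Integrable (fun ω ↦ κ * (presentSet N S n x₀ k).indicator (1 : Ω → ℝ) ω) P :=
    ((integrable_const (1 : ℝ)).indicator hpm).const_mul κ
  have key := E.integral_ite_event
    ((N.measurable_isArrival k).mono (ℱ.le _) le_rfl) (N.map_isArrival k) (N.indep_isArrival k)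
    (measurable_situation_comp N S n x₀ k (f true))
    (measurable_situation_comp N S n x₀ k (f false)) (hi true) (hi false)
  rw [← integral_const_mul, ← integral_const_mul,
    ← integral_add ((hi true).const_mul _) ((hi false).const_mul _)] at key
  rw [meanValue, meanValue, ← integral_indicator_one hpm, ← integral_const_mul,
    ← integral_add (hv k) hp]
  -- Pathwise drift, then averaging over the independent event, then the gain from reneging
  -- opponents.
  refine (integral_mono ((hv k).add hp) (((hi true).const_mul _).add ((hi false).const_mul _))
    fun ω ↦ ?_).trans (key.ge.trans (integral_mono ?_ (hv (k + 1)) fun ω ↦ ?_))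
  · have := Situation.value_add_le E hκ hδ
      (Situation.inRange_run hn x₀ (fun j ↦ N.isArrival j ω) (fun j ↦ S.leaves j ω) k)
    exact this
  · refine (((hi true).indicator (s := N.isArrival k ⁻¹' {true}) ?_).add
      ((hi false).indicator (s := N.isArrival k ⁻¹' {false}) ?_)).congr (.of_forall fun ω ↦ ?_)
    · exact ℱ.le _ _ (N.measurable_isArrival k (measurableSet_singleton _))
    · exact ℱ.le _ _ (N.measurable_isArrival k (measurableSet_singleton _))
    · cases h : N.isArrival k ω <;> simp [Set.indicator, h]
  · refine le_of_eq_of_le ?_ (Situation.value_le_value_afterOpponents hanti (S.leaves (k + 1) ω)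
      (situationBefore R N S n x₀ ω k))
    cases h : N.isArrival k ω <;> simp [f, situationBefore, h]

lemma add_sum_measureReal_presentSet_le (hn : 1 ≤ n) {κ δ : ℝ} (hκ : 0 ≤ κ) (hδ : 0 ≤ δ) (m : ℕ) :
    δ + κ * ∑ k ∈ Finset.range m, P.real (presentSet N S n x₀ k) ≤
      meanValue N S n x₀ (E.potential κ δ n) m := by
  induction m with
  | zero =>
    have hanti := E.potential_antitone hκ hδ n
    have hV := E.potential_nonneg hκ hδ n
    have : ∫ _ω : Ω, δ ∂P ≤ meanValue N S n x₀ (E.potential κ δ n) 0 := by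
      refine integral_mono (integrable_const δ) (integrable_situation_comp N S n x₀ 0
        (Situation.value_nonneg hV) (Situation.value_le hV hanti)) fun ω ↦ ?_
      refine le_of_eq_of_le ?_ (Situation.value_le_value_afterOpponents hanti (S.leaves 0 ω)
        (Situation.afterDecision n (Situation.inSystem x₀ n)))
      simp [Situation.afterDecision, Situation.value, E.potential_self]
    simpa using this
  | succ m ih =>
    rw [Finset.sum_range_succ]
    have := meanValue_add_le N S x₀ hn hκ hδ m
    linarith

/-- The crude bound `V 0` while she is present suffices, since the probability of presence tends to
`0`. -/
lemma meanValue_le {V : ℕ → ℝ} (hV : ∀ p, 0 ≤ V p) (hanti : Antitone V) (m : ℕ) :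
    meanValue N S n x₀ V m ≤
      V 0 * P.real (servedSet N S n x₀ m) + V 0 * P.real (presentSet N S n x₀ m) := by
  have hsm := measurableSet_servedSet N S n x₀ m
  have hpm := ℱ.le m _ (measurableSet_presentSet N S n x₀ m)
  have hi {A : Set Ω} (hA : MeasurableSet A) :
      Integrable (fun ω ↦ V 0 * A.indicator (1 : Ω → ℝ) ω) P :=
    ((integrable_const (1 : ℝ)).indicator hA).const_mul _
  rw [meanValue, ← integral_indicator_one hsm, ← integral_indicator_one hpm,
    ← integral_const_mul, ← integral_const_mul, ← integral_add (hi hsm) (hi hpm)]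
  refine integral_mono (integrable_situation_comp N S n x₀ m
    (Situation.value_nonneg hV) (Situation.value_le hV hanti)) ((hi hsm).add (hi hpm)) fun ω ↦ ?_
  cases h : situation R N S n x₀ ω m with
  | inSystem x p =>
    simpa [servedSet, presentSet, Set.indicator, h, Situation.IsPresent, Situation.value] using
      hanti (Nat.zero_le p)
  | served => simp [servedSet, presentSet, Set.indicator, h, Situation.IsPresent, Situation.value]
  | reneged => simp [servedSet, presentSet, Set.indicator, h, Situation.IsPresent, Situation.value]

lemma sum_measureReal_presentSet_le (hn : 1 ≤ n) (m : ℕ) :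
    ∑ k ∈ Finset.range m, P.real (presentSet N S n x₀ k) ≤ E.potential 1 0 n 0 := by
  have hanti := E.potential_antitone zero_le_one le_rfl n
  have hV := E.potential_nonneg zero_le_one le_rfl n
  have h1 := add_sum_measureReal_presentSet_le N S x₀ hn zero_le_one le_rfl m
  have h2 : meanValue N S n x₀ (E.potential 1 0 n) m ≤ ∫ _ω : Ω, E.potential 1 0 n 0 ∂P :=
    integral_mono (integrable_situation_comp N S n x₀ m (Situation.value_nonneg hV)
      (Situation.value_le hV hanti)) (integrable_const _) fun ω ↦ Situation.value_le hV hanti _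
  simp only [integral_const, probReal_univ, one_smul] at h2
  linarith

lemma summable_measureReal_presentSet (hn : 1 ≤ n) :
    Summable fun k ↦ P.real (presentSet N S n x₀ k) :=
  summable_of_sum_range_le (fun _ ↦ measureReal_nonneg) (sum_measureReal_presentSet_le N S x₀ hn)

end Customer

/-! ### Physical time and expected payoff -/

section Payoff

variable {E : Environment} {R : Regime.{u}} {Ω : Type v} [mΩ : MeasurableSpace Ω] {P : Measure Ω}
  {ℱ : Filtration ℕ mΩ} (N : EventProcess E P ℱ) (S : OpponentBehavior N) {n : ℕ} (x₀ : R.State)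

lemma measurable_duration_ofReal (k : ℕ) : Measurable fun ω ↦ ENNReal.ofReal (N.duration k ω) :=
  ENNReal.measurable_ofReal.comp ((N.measurable_duration k).mono (ℱ.le _) le_rfl)

lemma measurable_presentSet_mul (k : ℕ) : Measurable fun ω ↦
    (presentSet N S n x₀ k).indicator (1 : Ω → ℝ≥0∞) ω * ENNReal.ofReal (N.duration k ω) :=
  (measurable_one.indicator (ℱ.le k _ (measurableSet_presentSet N S n x₀ k))).mul
    (measurable_duration_ofReal N k)

lemma measurable_sojournTime : Measurable (sojournTime R N S n x₀) := by
  have : sojournTime R N S n x₀ = fun ω ↦ ∑' k, (presentSet N S n x₀ k).indicator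
      (1 : Ω → ℝ≥0∞) ω * ENNReal.ofReal (N.duration k ω) :=
    funext (sojournTime_eq N S n x₀)
  rw [this]
  exact Measurable.tsum (measurable_presentSet_mul N S x₀)

/-- Wald's argument: presence in round `k` is `ℱ k`-measurable, hence independent of the round's
length. -/
lemma lintegral_sojournTime : ∫⁻ ω, sojournTime R N S n x₀ ω ∂P =
    ∑' k, P (presentSet N S n x₀ k) * ENNReal.ofReal (E.lam + E.mu)⁻¹ := by
  simp_rw [sojournTime_eq]
  rw [lintegral_tsum fun k ↦ (measurable_presentSet_mul N S x₀ k).aemeasurable]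
  refine tsum_congr fun k ↦ ?_
  have hp := measurableSet_presentSet N S n x₀ k
  have hd : Measurable[MeasurableSpace.comap (N.duration k) inferInstance]
      fun ω ↦ ENNReal.ofReal (N.duration k ω) :=
    ENNReal.measurable_ofReal.comp (comap_measurable _)
  have hd' : Measurable (N.duration k) := (N.measurable_duration k).mono (ℱ.le _) le_rfl
  have h1 : Measurable[ℱ k] ((presentSet N S n x₀ k).indicator (1 : Ω → ℝ≥0∞)) :=
    Measurable.indicator (measurable_const (a := (1 : ℝ≥0∞))) hp
  rw [lintegral_mul_eq_lintegral_mul_lintegral_of_independent_measurableSpace (ℱ.le k)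
    hd'.comap_le (N.indep_duration k) h1 hd, lintegral_indicator_one (ℱ.le k _ hp),
    ← lintegral_ofReal_expMeasure (add_pos E.lam_pos E.mu_pos), ← N.map_duration k,
    lintegral_map ENNReal.measurable_ofReal hd']

lemma payoff_eq (ω : Ω) : payoff R N S n x₀ ω =
    E.r * (⋃ k, servedSet N S n x₀ k).indicator 1 ω -
      E.c * (sojournTime R N S n x₀ ω).toReal := by
  rw [payoff]
  have hiff : ω ∈ ⋃ k, servedSet N S n x₀ k ↔ ∃ k, situation R N S n x₀ ω k = .served :=
    Set.mem_iUnion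
  by_cases h : ω ∈ ⋃ k, servedSet N S n x₀ k
  · rw [if_pos (hiff.1 h), Set.indicator_of_mem h, Pi.one_apply, mul_one]
  · rw [if_neg (mt hiff.2 h), Set.indicator_of_notMem h, mul_zero]

lemma measurableSet_iUnion_servedSet : MeasurableSet (⋃ k, servedSet N S n x₀ k) :=
  MeasurableSet.iUnion (measurableSet_servedSet N S n x₀)

variable [IsProbabilityMeasure P]

lemma lintegral_sojournTime_ne_top (hn : 1 ≤ n) : ∫⁻ ω, sojournTime R N S n x₀ ω ∂P ≠ ∞ := by
  rw [lintegral_sojournTime, ENNReal.tsum_mul_right]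
  have h : ∑' k, P (presentSet N S n x₀ k) ≠ ∞ := by
    simpa [ofReal_measureReal] using
      (summable_measureReal_presentSet (P := P) N S x₀ hn).tsum_ofReal_ne_top
  exact ENNReal.mul_ne_top h ENNReal.ofReal_ne_top

lemma integral_sojournTime (hn : 1 ≤ n) : ∫ ω, (sojournTime R N S n x₀ ω).toReal ∂P =
    (E.lam + E.mu)⁻¹ * ∑' k, P.real (presentSet N S n x₀ k) := by
  rw [integral_toReal (measurable_sojournTime N S x₀).aemeasurable
    (ae_lt_top (measurable_sojournTime N S x₀) (lintegral_sojournTime_ne_top N S x₀ hn)),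
    lintegral_sojournTime, ENNReal.tsum_mul_right, ENNReal.toReal_mul,
    ENNReal.tsum_toReal_eq fun k ↦ measure_ne_top _ _,
    ENNReal.toReal_ofReal (inv_nonneg.2 (add_pos E.lam_pos E.mu_pos).le), mul_comm]
  rfl

lemma integrable_servedSet :
    Integrable (fun ω ↦ E.r * (⋃ k, servedSet N S n x₀ k).indicator (1 : Ω → ℝ) ω) P :=
  ((integrable_const (1 : ℝ)).indicator (measurableSet_iUnion_servedSet N S x₀)).const_mul _

lemma integrable_sojournTime (hn : 1 ≤ n) :
    Integrable (fun ω ↦ E.c * (sojournTime R N S n x₀ ω).toReal) P :=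
  (integrable_toReal_of_lintegral_ne_top (measurable_sojournTime N S x₀).aemeasurable
    (lintegral_sojournTime_ne_top N S x₀ hn)).const_mul _

lemma integrable_payoff (hn : 1 ≤ n) : Integrable (payoff R N S n x₀) P :=
  ((integrable_servedSet N S x₀).sub (integrable_sojournTime N S x₀ hn)).congr
    (.of_forall fun ω ↦ (payoff_eq N S x₀ ω).symm)

lemma integral_payoff (hn : 1 ≤ n) : ∫ ω, payoff R N S n x₀ ω ∂P =
    E.r * P.real (⋃ k, servedSet N S n x₀ k) -
      E.c / (E.lam + E.mu) * ∑' k, P.real (presentSet N S n x₀ k) := by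
  simp_rw [payoff_eq]
  rw [integral_sub (integrable_servedSet N S x₀) (integrable_sojournTime N S x₀ hn),
    integral_const_mul, integral_const_mul, integral_sojournTime N S x₀ hn,
    integral_indicator_one (measurableSet_iUnion_servedSet N S x₀)]
  ring

-- Limit of the summed submartingale inequality: since `V 0 = r`, the mean value is at most `r`
-- times the probability of having been served, up to a term that vanishes.
open Filter Topology in
lemma le_integral_payoff (hn : 1 ≤ n) {δ : ℝ} (hδ : 0 ≤ δ)
    (hr : E.potential (E.c / (E.lam + E.mu)) δ n 0 = E.r) :
    δ ≤ ∫ ω, payoff R N S n x₀ ω ∂P := by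
  have hκ : 0 ≤ E.c / (E.lam + E.mu) :=
    div_nonneg E.c_nonneg (add_pos E.lam_pos E.mu_pos).le
  have hsum := summable_measureReal_presentSet (P := P) N S x₀ hn
  have hmono : Monotone (servedSet N S n x₀) :=
    monotone_nat_of_le_succ fun k ω hω ↦ Situation.run_succ_eq_served hω
  have hserved : Tendsto (fun m ↦ P.real (servedSet N S n x₀ m)) atTop
      (𝓝 (P.real (⋃ k, servedSet N S n x₀ k))) :=
    (ENNReal.tendsto_toReal (measure_ne_top _ _)).comp (tendsto_measure_iUnion_atTop hmono)
  have hl := (hsum.hasSum.tendsto_sum_nat.const_mul (E.c / (E.lam + E.mu))).const_add δ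
  have hu := (hserved.const_mul E.r).add (hsum.tendsto_atTop_zero.const_mul E.r)
  have := le_of_tendsto_of_tendsto' hl hu fun m ↦
    (add_sum_measureReal_presentSet_le N S x₀ hn hκ hδ m).trans
      ((meanValue_le N S x₀ (E.potential_nonneg hκ hδ n) (E.potential_antitone hκ hδ n) m).trans_eq
        (by rw [hr]))
  rw [integral_payoff N S x₀ hn]
  linarith

end Payoff

/-- The expected payoff is well defined (finite expected time in the system, integrable payoff), it
is nonnegative if `D n ≥ 0`, and it is positive if `D n > 0`. -/
theorem mainTheorem5 (E : Environment) (R : Regime.{u}) {Ω : Type v} [mΩ : MeasurableSpace Ω]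
    (P : Measure Ω) [IsProbabilityMeasure P] (ℱ : Filtration ℕ mΩ) (N : EventProcess E P ℱ)
    (S : OpponentBehavior N) (n : ℕ) (hn : 1 ≤ n) (x₀ : R.State) (hx₀ : n ≤ R.size x₀) :
    (∫⁻ ω, sojournTime R N S n x₀ ω ∂P ≠ ∞ ∧ Integrable (payoff R N S n x₀) P) ∧
    (0 ≤ E.D n → 0 ≤ ∫ ω, payoff R N S n x₀ ω ∂P) ∧
    (0 < E.D n → 0 < ∫ ω, payoff R N S n x₀ ω ∂P) := by
  obtain ⟨δ, hr⟩ := E.exists_potential_zero_eq (E.c / (E.lam + E.mu)) E.r n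
  have hpos := E.theta_add_arrivalProb_pos n
  -- Since `theta n + arrivalProb > 0`, the sign of `D n` is that of `δ`.
  rw [E.D_eq hn hr]
  refine ⟨⟨lintegral_sojournTime_ne_top N S x₀ hn, integrable_payoff N S x₀ hn⟩, fun h ↦ ?_,
    fun h ↦ ?_⟩
  · have hδ := nonneg_of_mul_nonneg_left h hpos
    exact hδ.trans (le_integral_payoff N S x₀ hn hδ hr)
  · have hδ := pos_of_mul_pos_left h hpos.le
    exact hδ.trans_le (le_integral_payoff N S x₀ hn hδ.le hr)
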